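/- Let $X=[-\pi,\pi]$ with Lebesgue measure $dx$, and write $|f|_p=\left(\int_{-\pi}^{\pi}|f(x)|^p\,dx\right)^{1/p}$. Let $\psi\in U\Psi$ with $\operatorname{supp}\psi\supset(1,\infty)$; that is, $\psi$ is a positive finite continuous function on an open interval $(a,b)$, $1\le a<b\le\infty$, $\psi$ is regarded as equal to $\infty$ outside $(a,b)$, and $\operatorname{supp}\psi=\{p:\psi(p)<\infty\}=(a,b)$ contains $(1,\infty)$, so that $(a,b)=(1,\infty)$. For such $\psi$ let $G(\psi)$ be the space of measurable functions $f:X\to\mathbb R$ with finite norm $$\|f\|_{G(\psi)}=\sup_{p\in(1,\infty)}\frac{|f|_p}{\psi(p)},$$ and put $$\psi_{1,1}(p)=\frac{p^{2}\,\psi(p)}{p-1},\qquad p\in(1,\infty).$$ For $M\ge 1$ let $s_M$ be the Fourier partial-sum operator $$s_M[f](x)=\frac1{2\pi}\sum_{|n|\le M}c(n)e^{-inx},\qquad c(n)=\int_{-\pi}^{\pi}e^{inx}f(x)\,dx .$$ Then the operators $s_M$ are uniformly bounded from $G(\psi)$ into $G(\psi_{1,1})$: $$\sup_{M\ge1}\|s_M\|_{G(\psi)\to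 G(\psi_{1,1})}<\infty .$$ That is, there is a finite constant $C$ such that for all $M\ge1$ and all $f\in G(\psi)$ one has $s_M[f]\in G(\psi_{1,1})$ and $\|s_M[f]\|_{G(\psi_{1,1})}\le C\,\|f\|_{G(\psi)}$. -/

import Mathlib

open Set MeasureTheory
open scoped ENNReal

noncomputable section

namespace GPsi

/-- The open interval `(a, b)` of exponents, `a` real and `b` real or `+∞`. -/
def expInterval (a : ℝ) (b : EReal) : Set ℝ := {p : ℝ | a < p ∧ (p : EReal) < b}

/-- The class `UΨ(a, b)`, `1 ≤ a < b ≤ ∞`: positive (finite) continuous functions on the open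
interval `(a, b)`. Such a function is regarded as a `[0, ∞]`-valued function on the real line with
the value `∞` outside `(a, b)`. -/
structure IsUPsi (a : ℝ) (b : EReal) (ψ : ℝ → ℝ≥0∞) : Prop where
  one_le : 1 ≤ a
  lt : (a : EReal) < b
  pos : ∀ p ∈ expInterval a b, 0 < ψ p
  lt_top : ∀ p ∈ expInterval a b, ψ p < ∞
  continuousOn : ContinuousOn ψ (expInterval a b)
  eq_top : ∀ p, p ∉ expInterval a b → ψ p = ∞

/-- `supp ψ = {p : ψ(p) < ∞}`. -/
def psiSupp (ψ : ℝ → ℝ≥0∞) : Set ℝ := {p : ℝ | ψ p < ∞}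

theorem IsUPsi.psiSupp_eq {a : ℝ} {b : EReal} {ψ : ℝ → ℝ≥0∞} (h : IsUPsi a b ψ) :
    psiSupp ψ = expInterval a b := by
  ext p
  refine ⟨fun hp => ?_, fun hp => h.lt_top p hp⟩
  by_contra hn
  exact absurd (h.eq_top p hn) (ne_of_lt hp)

/-- The norm `‖f‖G(ψ) = sup_p |f|_p / ψ(p)`, the supremum over `p ∈ (a, b) = supp ψ`. -/
def gNorm {X : Type*} [MeasurableSpace X] (ψ : ℝ → ℝ≥0∞) (μ : Measure X) (f : X → ℝ) : ℝ≥0∞ :=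
  ⨆ p ∈ psiSupp ψ, eLpNorm f (ENNReal.ofReal p) μ / ψ p

/-- `f ∈ G(ψ) = G(X, ψ, μ)`: `f` is measurable and has finite `G(ψ)`-norm. -/
def MemG {X : Type*} [MeasurableSpace X] (ψ : ℝ → ℝ≥0∞) (μ : Measure X) (f : X → ℝ) : Prop :=
  AEStronglyMeasurable f μ ∧ gNorm ψ μ f < ∞

/-- The operator norm `‖Q‖[G(ψ) → G(ν)]`: the least `C ∈ [0, ∞]` such that `Q` maps `G(ψ)` into
`G(ν)` with `‖Q f‖G(ν) ≤ C ‖f‖G(ψ)`; it is `∞` if there is no such `C`. -/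
def gOpNorm {X : Type*} [MeasurableSpace X] (ψ ν : ℝ → ℝ≥0∞) (μ : Measure X)
    (Q : (X → ℝ) → (X → ℝ)) : ℝ≥0∞ :=
  sInf {C : ℝ≥0∞ | ∀ f : X → ℝ, MemG ψ μ f →
    MemG ν μ (Q f) ∧ gNorm ν μ (Q f) ≤ C * gNorm ψ μ f}

/-- `ψ_{λ,γ}(p) = p^{λ+γ} ψ(p) (p-1)^{-γ}` for `p ∈ (1, ∞)` (and `∞` outside `(1, ∞)`). -/
def psiLG (l g : ℝ) (ψ : ℝ → ℝ≥0∞) (p : ℝ) : ℝ≥0∞ :=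
  if 1 < p then ENNReal.ofReal (p ^ (l + g) * (p - 1) ^ (-g)) * ψ p else ∞

/-- For `ψ ∈ UΨ(1, ∞)` also `ψ_{λ,γ} ∈ UΨ(1, ∞)`. -/
theorem IsUPsi.psiLG {ψ : ℝ → ℝ≥0∞} (h : IsUPsi 1 ⊤ ψ) (l g : ℝ) :
    IsUPsi 1 ⊤ (psiLG l g ψ) := by
  have hmem : ∀ p : ℝ, p ∈ expInterval 1 ⊤ ↔ 1 < p := fun p => by
    simp [expInterval, EReal.coe_lt_top]
  have hpos : ∀ p : ℝ, 1 < p → 0 < p ^ (l + g) * (p - 1) ^ (-g) := fun p hp =>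
    mul_pos (Real.rpow_pos_of_pos (by linarith) _) (Real.rpow_pos_of_pos (by linarith) _)
  refine ⟨le_rfl, h.lt, fun p hp => ?_, fun p hp => ?_, ?_, fun p hp => ?_⟩
  · have h1 := (hmem p).1 hp
    simp only [GPsi.psiLG, if_pos h1]
    exact ENNReal.mul_pos (by simpa using hpos p h1) (h.pos p hp).ne'
  · have h1 := (hmem p).1 hp
    simp only [GPsi.psiLG, if_pos h1]
    exact ENNReal.mul_lt_top ENNReal.ofReal_lt_top (h.lt_top p hp)
  · have hc : ContinuousOn
        (fun p : ℝ => ENNReal.ofReal (p ^ (l + g) * (p - 1) ^ (-g)) * ψ p) (expInterval 1 ⊤) := by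
      intro p hp
      have h1 := (hmem p).1 hp
      refine ENNReal.Tendsto.mul ?_ (Or.inl ?_) (h.continuousOn p hp) (Or.inr ENNReal.ofReal_ne_top)
      · refine (ENNReal.continuous_ofReal.continuousAt.comp ?_).continuousWithinAt
        exact (Real.continuousAt_rpow_const _ _ (Or.inl (by linarith))).mul
          ((continuousAt_id.sub continuousAt_const).rpow_const
            (Or.inl (sub_pos.2 h1).ne'))
      · simpa using hpos p h1
    exact hc.congr fun p hp => if_pos ((hmem p).1 hp)
  · have h1 : ¬ 1 < p := fun h1 => hp ((hmem p).2 h1)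
    simp [GPsi.psiLG, h1]

/-- Lebesgue measure on `X = [-π, π]`. -/
def muPi : Measure ℝ := volume.restrict (Icc (-Real.pi) Real.pi)

/-- `c(n) = c(n, f) = ∫_{-π}^{π} exp(i n x) f(x) dx`. -/
def fourierC (f : ℝ → ℝ) (n : ℤ) : ℂ :=
  ∫ x, Complex.exp (Complex.I * n * x) * (f x : ℂ) ∂muPi

/-- `(2π)⁻¹ ∑_{|n| ≤ M} c(n) exp(-i n x)`, as a complex number. -/
def fourierSumC (M : ℕ) (f : ℝ → ℝ) (x : ℝ) : ℂ :=
  (2 * (Real.pi : ℂ))⁻¹ *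
    ∑ n ∈ Finset.Icc (-(M : ℤ)) (M : ℤ), fourierC f n * Complex.exp (-(Complex.I * n * x))

/-- The Fourier partial sum `s_M[f](x)` of a real function `f`, as a real number
(see `fourierSum_eq`). -/
def fourierSum (M : ℕ) (f : ℝ → ℝ) (x : ℝ) : ℝ := (fourierSumC M f x).re

/-- The partial sum of a real function is real. -/
theorem fourierSum_eq (M : ℕ) (f : ℝ → ℝ) (x : ℝ) :
    (fourierSum M f x : ℂ) = fourierSumC M f x := by
  have hc : ∀ n : ℤ, (starRingEnd ℂ) (fourierC f n) = fourierC f (-n) := fun n => by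
    unfold fourierC
    rw [← integral_conj]
    refine integral_congr_ae (Filter.Eventually.of_forall fun y => ?_)
    simp [← Complex.exp_conj]
  refine Complex.conj_eq_iff_re.1 ?_
  unfold fourierSumC
  rw [map_mul, map_sum]
  congr 1
  · rw [map_inv₀, map_mul, Complex.conj_ofReal, Complex.conj_ofNat]
  · refine Finset.sum_nbij' (fun n => -n) (fun n => -n) ?_ ?_ ?_ ?_ ?_
    · intro n hn
      rw [Finset.mem_Icc] at hn ⊢
      omega
    · intro n hn
      rw [Finset.mem_Icc] at hn ⊢
      omega
    · intro n _
      simp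
    · intro n _
      simp
    · intro n _
      rw [map_mul, hc]
      simp [← Complex.exp_conj]

end GPsi

end

noncomputable section
namespace GPsi

/-! The weight `p ^ 2 / (p - 1)` is the growth of the constant in M. Riesz's theorem, so everything
reduces to `eLpNorm_fourierSum_le`: a bound `784 * p ^ 2 / (p - 1)` for the partial sums on `L^p`,
uniform in `M`. Dividing by the weight and by `ψ p` and taking the supremum then gives the theorem.

For `1 < p ≤ 2` the bound comes from Riesz's complex-analytic argument. The Cauchy transform `F` of
a nonnegative, not almost everywhere zero `h` maps the disc into the right half-plane, so `F ^ p` is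
holomorphic. There `norm_rpow_le_re_rpow_sub` dominates `‖F‖ ^ p` by `(Re F) ^ p` minus a positive
multiple of `Re (F ^ p)`. The latter has mean `F(0) ^ p ≥ 0` over circles and drops out, while `Re
F` is an average of `h` and hence contracts `L^p` (`lintegral_reCauchy_conv_rpow_le`). Splitting
into four nonnegative parts covers complex functions.

A finite geometric sum is a difference of two Cauchy kernels, so a damped partial sum is a
combination of two modulated Cauchy transforms (`dampedSum_eq`); Fatou removes the damping. For `p >
2`, symmetry of the partial sums gives the bound by duality. -/

/-! ### The pointwise inequality in the right half-plane. -/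

/-- Bernoulli's inequality gives `(6 / s) ^ s ≤ 7 - s`: the power `s ^ s` does not degenerate as `s
→ 0`, which keeps the final constant of order `1 / (p - 1)`. -/
theorem inv_seven_le_rpow {s y : ℝ} (hs : 0 < s) (hs1 : s ≤ 1) (hy : s / 6 ≤ y) :
    1 / 7 ≤ y ^ s := by
  have h6 : 0 < s / 6 := by positivity
  have hB := rpow_one_add_le_one_add_mul_self (s := 6 / s - 1)
    (by have : 0 < 6 / s := by positivity
        linarith) hs.le hs1
  have e : 1 + s * (6 / s - 1) = 7 - s := by field_simp; ring
  rw [e, add_sub_cancel] at hB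
  have h1 : (s / 6) ^ s ≤ y ^ s := Real.rpow_le_rpow h6.le hy hs.le
  refine le_trans ?_ h1
  have : s / 6 = (6 / s)⁻¹ := by rw [inv_div]
  rw [this, Real.inv_rpow (by positivity), one_div]
  exact inv_anti₀ (by positivity) (by linarith)

theorem one_sub_sin_le {s φ : ℝ} (hs : 0 < s) (hs1 : s ≤ 1) (h0 : 0 ≤ φ)
    (h1 : φ ≤ Real.pi / 2) :
    1 - 2 / s * Real.sin (s * Real.pi / 2 - (1 + s) * φ) ≤
      98 / s * Real.sin φ ^ (1 + s) := by
  have hpi := Real.pi_gt_three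
  have hpi4 := Real.pi_le_four
  have hsin : φ / 2 ≤ Real.sin φ := by
    refine le_trans ?_ (Real.mul_le_sin h0 h1)
    have : 1 / 2 ≤ 2 / Real.pi := by
      rw [div_le_div_iff₀ two_pos Real.pi_pos]; linarith
    nlinarith
  -- For small `φ` the sine is at least `s / 2` and the left side is nonpositive. Otherwise `s` is
  -- at most a multiple of `φ`, the left side is at most `7 * φ / s`, and `98 = 7 * 2 * 7` absorbs
  -- `sin φ ≥ φ / 2` and `(φ / 2) ^ s ≥ 1 / 7`.
  rcases le_total φ (s * Real.pi / 8) with h | h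
  · have hx1 : s * Real.pi / 4 ≤ s * Real.pi / 2 - (1 + s) * φ := by nlinarith
    have hx2 : s * Real.pi / 2 - (1 + s) * φ ≤ Real.pi / 2 := by nlinarith
    have h2 := Real.mul_le_sin (le_trans (by positivity) hx1) hx2
    have h3 : s / 2 ≤ 2 / Real.pi * (s * Real.pi / 2 - (1 + s) * φ) := by
      calc s / 2 = 2 / Real.pi * (s * Real.pi / 4) := by field_simp; ring
        _ ≤ _ := by gcongr
    have h4 : 1 ≤ 2 / s * Real.sin (s * Real.pi / 2 - (1 + s) * φ) := by
      calc 1 = 2 / s * (s / 2) := by field_simp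
        _ ≤ _ := by gcongr; exact h3.trans h2
    have h5 : 0 ≤ 98 / s * Real.sin φ ^ (1 + s) := by
      have : 0 ≤ Real.sin φ := le_trans (by positivity) hsin
      positivity
    linarith
  · have hφ : 0 < φ := lt_of_lt_of_le (by positivity) h
    have hlow : -((1 + s) * φ) ≤ Real.sin (s * Real.pi / 2 - (1 + s) * φ) := by
      rcases le_total 0 (s * Real.pi / 2 - (1 + s) * φ) with hx | hx
      · refine le_trans ?_ (Real.sin_nonneg_of_nonneg_of_le_pi hx (by nlinarith))
        nlinarith
      · refine le_trans ?_ (Real.le_sin hx)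
        nlinarith
    have h2 : 1 - 2 / s * Real.sin (s * Real.pi / 2 - (1 + s) * φ) ≤ 7 * φ / s := by
      have a1 : 2 / s * -((1 + s) * φ) ≤
          2 / s * Real.sin (s * Real.pi / 2 - (1 + s) * φ) := by gcongr
      have a2 : 2 / s * ((1 + s) * φ) ≤ 4 * φ / s := by
        rw [div_mul_eq_mul_div]; gcongr ?_ / s; nlinarith
      have a3 : 1 ≤ 3 * φ / s := by rw [le_div_iff₀ hs]; nlinarith
      have a4 : 7 * φ / s = 4 * φ / s + 3 * φ / s := by ring
      linarith
    refine h2.trans ?_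
    have h3 : (φ / 2) ^ (1 + s) ≤ Real.sin φ ^ (1 + s) :=
      Real.rpow_le_rpow (by positivity) hsin (by positivity)
    have h4 : (1 / 7 : ℝ) ≤ (φ / 2) ^ s := inv_seven_le_rpow hs hs1 (by nlinarith)
    rw [Real.rpow_add (by positivity), Real.rpow_one] at h3
    calc 7 * φ / s = 98 / s * (φ / 2 * (1 / 7)) := by ring
      _ ≤ 98 / s * (φ / 2 * (φ / 2) ^ s) := by gcongr
      _ ≤ _ := by gcongr

/-- After division by `‖w‖ ^ p` this is `one_sub_sin_le` with `s = p - 1` and `φ` the angle from `w`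
to the imaginary axis. Near that axis `cos (p * arg w)` is negative, which compensates for the
smallness of `w.re`. -/
theorem norm_rpow_le_re_rpow_sub {p : ℝ} (hp : 1 < p) (hp2 : p ≤ 2) {w : ℂ} (hw : 0 < w.re) :
    ‖w‖ ^ p ≤ 98 / (p - 1) * w.re ^ p - 2 / (p - 1) * (w ^ (p : ℂ)).re := by
  have harg : |w.arg| < Real.pi / 2 := Complex.abs_arg_lt_pi_div_two_iff.2 (Or.inl hw)
  have key := one_sub_sin_le (s := p - 1) (φ := Real.pi / 2 - |w.arg|) (by linarith)
    (by linarith) (by linarith) (by linarith [abs_nonneg w.arg])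
  have e1 : Real.sin (Real.pi / 2 - |w.arg|) = Real.cos w.arg := by
    rw [Real.sin_pi_div_two_sub, Real.cos_abs]
  have e2 : Real.sin ((p - 1) * Real.pi / 2 - (1 + (p - 1)) * (Real.pi / 2 - |w.arg|))
      = - Real.cos (w.arg * p) := by
    rw [← Real.cos_abs (w.arg * p), abs_mul, abs_of_pos (by linarith : 0 < p),
      ← Real.sin_sub_pi_div_two]
    congr 1; ring
  rw [e1, e2, add_sub_cancel] at key
  rw [Complex.cpow_ofReal_re]
  have hn : 0 < ‖w‖ := by
    rw [norm_pos_iff]; rintro rfl; simp at hw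
  have hre : w.re ^ p = ‖w‖ ^ p * Real.cos w.arg ^ p := by
    rw [← Real.mul_rpow hn.le]
    · rw [Complex.norm_mul_cos_arg]
    · exact Real.cos_nonneg_of_mem_Icc ⟨by linarith [(abs_lt.1 harg).1], (abs_lt.1 harg).2.le⟩
  rw [hre]
  have := mul_le_mul_of_nonneg_left key (Real.rpow_nonneg hn.le p)
  linarith

/-! ### Schur's test and integrals over a period. -/

instance : IsFiniteMeasure muPi := by unfold muPi; infer_instance

/-- Schur test for kernels with both marginals at most one. -/
theorem lintegral_kernel_rpow_le {α β : Type*} [MeasurableSpace α] [MeasurableSpace β]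
    {μ : Measure α} {ν : Measure β} [SFinite μ] [SFinite ν] {p : ℝ} (hp : 1 < p)
    {k : α → β → ℝ≥0∞} (hk : Measurable (Function.uncurry k))
    (h1 : ∀ x, ∫⁻ t, k x t ∂ν ≤ 1) (h2 : ∀ t, ∫⁻ x, k x t ∂μ ≤ 1)
    {h : β → ℝ≥0∞} (hh : AEMeasurable h ν) :
    ∫⁻ x, (∫⁻ t, k x t * h t ∂ν) ^ p ∂μ ≤ ∫⁻ t, h t ^ p ∂ν := by
  have hp0 : 0 < p := by linarith
  have hpq := Real.HolderConjugate.conjExponent hp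
  set q := p.conjExponent
  have hkx : ∀ x, Measurable (k x) := fun x => hk.comp measurable_prodMk_left
  have hkt : ∀ t, Measurable fun x => k x t := fun t => hk.comp measurable_prodMk_right
  have step : ∀ x, (∫⁻ t, k x t * h t ∂ν) ^ p ≤ ∫⁻ t, k x t * h t ^ p ∂ν := by
    intro x
    -- Hölder with the kernel split as `k = k ^ (1 / q) * k ^ (1 / p)`; the first factor has norm at
    -- most one.
    have H := ENNReal.lintegral_mul_le_Lp_mul_Lq ν hpq.symm
      (f := fun t => k x t ^ (1 / q)) (g := fun t => k x t ^ (1 / p) * h t)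
      ((hkx x).pow_const _).aemeasurable (((hkx x).pow_const _).aemeasurable.mul hh)
    have e1 : ∀ t, ((fun t => k x t ^ (1 / q)) * fun t => k x t ^ (1 / p) * h t) t
        = k x t * h t := by
      intro t
      simp only [Pi.mul_apply]
      rw [← mul_assoc, ← ENNReal.rpow_add_of_nonneg _ _ hpq.symm.one_div_nonneg
        hpq.one_div_nonneg]
      have : 1 / q + 1 / p = 1 := by
        simpa using hpq.symm.inv_add_inv_eq_one
      rw [this, ENNReal.rpow_one]
    have e2 : ∀ t, (k x t ^ (1 / q)) ^ q = k x t := fun t => by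
      rw [← ENNReal.rpow_mul, one_div_mul_cancel hpq.symm.ne_zero, ENNReal.rpow_one]
    have e3 : ∀ t, (k x t ^ (1 / p) * h t) ^ p = k x t * h t ^ p := fun t => by
      rw [ENNReal.mul_rpow_of_nonneg _ _ hp0.le, ← ENNReal.rpow_mul,
        one_div_mul_cancel hp0.ne', ENNReal.rpow_one]
    simp_rw [e1, e2, e3] at H
    have H2 : ∫⁻ t, k x t * h t ∂ν ≤ (∫⁻ t, k x t * h t ^ p ∂ν) ^ (1 / p) := by
      refine H.trans (mul_le_of_le_one_left' ?_)
      exact ENNReal.rpow_le_one (h1 x) hpq.symm.one_div_nonneg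
    calc _ ≤ ((∫⁻ t, k x t * h t ^ p ∂ν) ^ (1 / p)) ^ p := ENNReal.rpow_le_rpow H2 hp0.le
      _ = _ := by rw [← ENNReal.rpow_mul, one_div_mul_cancel hp0.ne', ENNReal.rpow_one]
  calc _ ≤ ∫⁻ x, ∫⁻ t, k x t * h t ^ p ∂ν ∂μ := lintegral_mono step
    _ = ∫⁻ t, ∫⁻ x, k x t * h t ^ p ∂μ ∂ν := by
      refine lintegral_lintegral_swap ?_
      exact hk.aemeasurable.mul ((hh.pow_const p).comp_quasiMeasurePreserving
        Measure.quasiMeasurePreserving_snd)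
    _ = ∫⁻ t, (∫⁻ x, k x t ∂μ) * h t ^ p ∂ν := by
      refine lintegral_congr fun t => ?_
      rw [lintegral_mul_const _ (hkt t)]
    _ ≤ _ := lintegral_mono fun t => mul_le_of_le_one_left' (h2 t)

theorem integral_muPi {E : Type*} [NormedAddCommGroup E] [NormedSpace ℝ E] (P : ℝ → E) :
    ∫ x, P x ∂muPi = ∫ x in (-Real.pi)..Real.pi, P x := by
  rw [muPi, intervalIntegral.integral_of_le (by linarith [Real.pi_pos]), integral_Icc_eq_integral_Ioc]

theorem _root_.Function.Periodic.integral_muPi {E : Type*} [NormedAddCommGroup E]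
    [NormedSpace ℝ E] {P : ℝ → E} (hP : Function.Periodic P (2 * Real.pi)) :
    ∫ x, P x ∂muPi = ∫ x in 0..2 * Real.pi, P x := by
  have := hP.intervalIntegral_add_eq (-Real.pi) 0
  rw [GPsi.integral_muPi]
  convert this using 2 <;> ring

theorem _root_.Function.Periodic.integral_muPi_sub_right {E : Type*} [NormedAddCommGroup E]
    [NormedSpace ℝ E] {P : ℝ → E} (hP : Function.Periodic P (2 * Real.pi)) (t : ℝ) :
    ∫ x, P (x - t) ∂muPi = ∫ x in 0..2 * Real.pi, P x := by
  have := hP.intervalIntegral_add_eq (-Real.pi - t) 0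
  rw [GPsi.integral_muPi, intervalIntegral.integral_comp_sub_right]
  convert this using 2 <;> ring

theorem _root_.Function.Periodic.integral_muPi_sub_left {E : Type*} [NormedAddCommGroup E]
    [NormedSpace ℝ E] {P : ℝ → E} (hP : Function.Periodic P (2 * Real.pi)) (x : ℝ) :
    ∫ t, P (x - t) ∂muPi = ∫ x in 0..2 * Real.pi, P x := by
  have := hP.intervalIntegral_add_eq (x - Real.pi) 0
  rw [GPsi.integral_muPi, intervalIntegral.integral_comp_sub_left]
  convert this using 2 <;> ring

theorem integral_muPi_circleMap {f : ℂ → ℂ} {r : ℝ} (hr0 : 0 ≤ r) (hr : r < 1)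
    (hf : DifferentiableOn ℂ f (Metric.ball 0 1)) :
    ∫ x, f (circleMap 0 r x) ∂muPi = 2 * Real.pi * f 0 := by
  have hper : Function.Periodic (fun x => f (circleMap 0 r x)) (2 * Real.pi) :=
    fun x => by simp only [periodic_circleMap 0 r x]
  have hsub : closure (Metric.ball (0 : ℂ) |r|) ⊆ Metric.ball 0 1 := by
    refine Metric.closure_ball_subset_closedBall.trans (Metric.closedBall_subset_ball ?_)
    rwa [abs_of_nonneg hr0]
  have h := (hf.mono hsub).diffContOnCl.circleAverage
  rw [Real.circleAverage_def] at h
  rw [hper.integral_muPi, ← h, Complex.real_smul]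
  push_cast
  field_simp

/-! ### The real part of the Cauchy kernel as an averaging kernel. -/

/-- The real part of the Cauchy kernel `1 / (1 - r exp(i y))`. -/
def reCauchy (r y : ℝ) : ℝ := ((1 - circleMap 0 r y)⁻¹).re

theorem norm_circleMap_lt {r : ℝ} (hr0 : 0 ≤ r) (hr : r < 1) (y : ℝ) :
    ‖circleMap 0 r y‖ < 1 := by simpa [abs_of_nonneg hr0] using hr

theorem one_sub_ne_zero_of_norm_lt {z : ℂ} (hz : ‖z‖ < 1) : 1 - z ≠ 0 := by
  intro h
  rw [← sub_eq_zero.1 h] at hz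
  simp at hz

/-- Inversion sends the disc about `1` of radius `1` to the half-plane `Re > 1 / 2`. This makes the
kernel positive and the real part of the Cauchy transform strictly positive. -/
theorem half_le_re_inv_one_sub {z : ℂ} (hz : ‖z‖ < 1) : 1 / 2 ≤ ((1 - z)⁻¹).re := by
  have h0 := one_sub_ne_zero_of_norm_lt hz
  have hn : 0 < Complex.normSq (1 - z) := Complex.normSq_pos.2 h0
  rw [Complex.inv_re, le_div_iff₀ hn, Complex.normSq_apply]
  have h1 : Complex.normSq z < 1 := by
    rw [Complex.normSq_eq_norm_sq]; nlinarith [norm_nonneg z]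
  rw [Complex.normSq_apply] at h1
  simp only [Complex.sub_re, Complex.sub_im, Complex.one_re, Complex.one_im]
  nlinarith

theorem continuous_inv_one_sub_circleMap {r : ℝ} (hr0 : 0 ≤ r) (hr : r < 1) :
    Continuous fun y => (1 - circleMap 0 r y)⁻¹ :=
  (continuous_const.sub (continuous_circleMap 0 r)).inv₀ fun y =>
    one_sub_ne_zero_of_norm_lt (norm_circleMap_lt hr0 hr y)

theorem continuous_reCauchy {r : ℝ} (hr0 : 0 ≤ r) (hr : r < 1) : Continuous (reCauchy r) :=
  Complex.continuous_re.comp (continuous_inv_one_sub_circleMap hr0 hr)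

theorem half_le_reCauchy {r : ℝ} (hr0 : 0 ≤ r) (hr : r < 1) (y : ℝ) : 1 / 2 ≤ reCauchy r y :=
  half_le_re_inv_one_sub (norm_circleMap_lt hr0 hr y)

theorem periodic_reCauchy (r : ℝ) : Function.Periodic (reCauchy r) (2 * Real.pi) :=
  fun y => by simp only [reCauchy, periodic_circleMap 0 r y]

theorem _root_.Continuous.integrable_muPi {E : Type*} [NormedAddCommGroup E] {f : ℝ → E}
    (hf : Continuous f) : Integrable f muPi :=
  hf.integrableOn_Icc

theorem integral_reCauchy {r : ℝ} (hr0 : 0 ≤ r) (hr : r < 1) :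
    ∫ y in 0..2 * Real.pi, reCauchy r y = 2 * Real.pi := by
  have hd : DifferentiableOn ℂ (fun z : ℂ => (1 - z)⁻¹) (Metric.ball 0 1) := by
    refine ((differentiableOn_const _).sub differentiableOn_id).inv fun z hz => ?_
    exact one_sub_ne_zero_of_norm_lt (by simpa using hz)
  have h := integral_muPi_circleMap hr0 hr hd
  rw [← (periodic_reCauchy r).integral_muPi]
  have h2 := integral_re (𝕜 := ℂ) (continuous_inv_one_sub_circleMap hr0 hr).integrable_muPi
  simp only [RCLike.re_to_complex] at h2
  unfold reCauchy
  rw [h2, h]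
  simp

theorem lintegral_muPi_eq {f : ℝ → ℝ} (hf : Continuous f) (h0 : ∀ x, 0 ≤ f x)
    (h : ∫ x, f x ∂muPi = 2 * Real.pi) :
    ∫⁻ x, ENNReal.ofReal ((2 * Real.pi)⁻¹ * f x) ∂muPi = 1 := by
  rw [← ofReal_integral_eq_lintegral_ofReal (hf.integrable_muPi.const_mul _)
    (Filter.Eventually.of_forall fun x => mul_nonneg (by positivity) (h0 x)),
    integral_const_mul, h, inv_mul_cancel₀ (by positivity), ENNReal.ofReal_one]

theorem lintegral_reCauchy_conv_rpow_le {r p : ℝ} (hr0 : 0 ≤ r) (hr : r < 1) (hp : 1 < p)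
    {h : ℝ → ℝ≥0∞} (hh : AEMeasurable h muPi) :
    ∫⁻ x, (∫⁻ t, ENNReal.ofReal ((2 * Real.pi)⁻¹ * reCauchy r (x - t)) * h t ∂muPi) ^ p ∂muPi
      ≤ ∫⁻ t, h t ^ p ∂muPi := by
  have hc := continuous_reCauchy hr0 hr
  have h0 : ∀ y, 0 ≤ reCauchy r y := fun y => le_trans (by norm_num) (half_le_reCauchy hr0 hr y)
  refine lintegral_kernel_rpow_le hp ?_ (fun x => ?_) (fun t => ?_) hh
  · refine ENNReal.measurable_ofReal.comp (Continuous.measurable ?_)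
    exact continuous_const.mul (hc.comp (continuous_fst.sub continuous_snd))
  · refine (lintegral_muPi_eq (f := fun t => reCauchy r (x - t))
      (hc.comp (continuous_const.sub continuous_id)) (fun _ => h0 _) ?_).le
    rw [(periodic_reCauchy r).integral_muPi_sub_left, integral_reCauchy hr0 hr]
  · refine (lintegral_muPi_eq (f := fun x => reCauchy r (x - t))
      (hc.comp (continuous_id.sub continuous_const)) (fun _ => h0 _) ?_).le
    rw [(periodic_reCauchy r).integral_muPi_sub_right, integral_reCauchy hr0 hr]

/-! ### The Cauchy transform: holomorphy and positivity. -/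

/-- The Cauchy transform `(2π)⁻¹ ∫ g(t) / (1 - z exp(-i t)) dt` of a function on `[-π, π]`. -/
def cauchyT (g : ℝ → ℂ) (z : ℂ) : ℂ :=
  (2 * (Real.pi : ℂ))⁻¹ * ∫ t, g t * (1 - z * Complex.exp (-(Complex.I * t)))⁻¹ ∂muPi

theorem norm_exp_neg_I_mul (t : ℝ) : ‖Complex.exp (-(Complex.I * t))‖ = 1 := by
  rw [Complex.norm_exp]; simp

theorem norm_mul_exp_neg_I_mul (z : ℂ) (t : ℝ) : ‖z * Complex.exp (-(Complex.I * t))‖ = ‖z‖ := by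
  rw [norm_mul, norm_exp_neg_I_mul, mul_one]

theorem one_sub_norm_le (z : ℂ) (t : ℝ) :
    1 - ‖z‖ ≤ ‖1 - z * Complex.exp (-(Complex.I * t))‖ := by
  have := norm_sub_norm_le (1 : ℂ) (z * Complex.exp (-(Complex.I * t)))
  rwa [norm_mul_exp_neg_I_mul, norm_one] at this

theorem continuous_cauchyKernel {z : ℂ} (hz : ‖z‖ < 1) :
    Continuous fun t : ℝ => (1 - z * Complex.exp (-(Complex.I * t)))⁻¹ := by
  refine Continuous.inv₀ (by fun_prop) fun t => ?_
  exact one_sub_ne_zero_of_norm_lt (by rwa [norm_mul_exp_neg_I_mul])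

theorem norm_cauchyKernel_le {z : ℂ} (hz : ‖z‖ < 1) (t : ℝ) :
    ‖(1 - z * Complex.exp (-(Complex.I * t)))⁻¹‖ ≤ (1 - ‖z‖)⁻¹ := by
  rw [norm_inv]
  exact inv_anti₀ (by linarith) (one_sub_norm_le z t)

theorem integrable_mul_cauchyKernel {g : ℝ → ℂ} (hg : Integrable g muPi) {z : ℂ} (hz : ‖z‖ < 1) :
    Integrable (fun t => g t * (1 - z * Complex.exp (-(Complex.I * t)))⁻¹) muPi :=
  hg.mul_bdd (c := (1 - ‖z‖)⁻¹) (continuous_cauchyKernel hz).aestronglyMeasurable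
    (Filter.Eventually.of_forall fun t => norm_cauchyKernel_le hz t)

theorem cauchyT_zero (g : ℝ → ℂ) : cauchyT g 0 = (2 * (Real.pi : ℂ))⁻¹ * ∫ t, g t ∂muPi := by
  simp [cauchyT]

theorem cauchyT_add {f g : ℝ → ℂ} (hf : Integrable f muPi) (hg : Integrable g muPi) {z : ℂ}
    (hz : ‖z‖ < 1) : cauchyT (fun t => f t + g t) z = cauchyT f z + cauchyT g z := by
  unfold cauchyT
  simp_rw [add_mul]
  rw [integral_add (integrable_mul_cauchyKernel hf hz) (integrable_mul_cauchyKernel hg hz), mul_add]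

theorem cauchyT_const_mul (c : ℂ) (g : ℝ → ℂ) (z : ℂ) :
    cauchyT (fun t => c * g t) z = c * cauchyT g z := by
  unfold cauchyT
  simp_rw [mul_assoc c]
  rw [integral_const_mul]
  ring

theorem differentiableOn_cauchyT {g : ℝ → ℂ} (hg : Integrable g muPi) :
    DifferentiableOn ℂ (cauchyT g) (Metric.ball 0 1) := by
  intro z hz
  have hz1 : ‖z‖ < 1 := by simpa using hz
  -- On the smaller disc of radius `ρ` the derivative of the kernel is bounded by `(1 - ρ)⁻¹ ^ 2`,
  -- uniformly in `t`, so differentiation under the integral is allowed.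
  obtain ⟨ρ, hzρ, hρ⟩ := exists_between hz1
  refine DifferentiableAt.differentiableWithinAt (DifferentiableAt.const_mul ?_ _)
  have hs : Metric.ball (0 : ℂ) ρ ∈ nhds z := Metric.isOpen_ball.mem_nhds (by simpa using hzρ)
  refine (hasDerivAt_integral_of_dominated_loc_of_deriv_le (𝕜 := ℂ) (s := Metric.ball (0 : ℂ) ρ)
    (F := fun z t => g t * (1 - z * Complex.exp (-(Complex.I * t)))⁻¹)
    (F' := fun z t => g t * (Complex.exp (-(Complex.I * t)) /
      (1 - z * Complex.exp (-(Complex.I * t))) ^ 2))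
    (bound := fun t => ‖g t‖ * ((1 - ρ)⁻¹) ^ 2) hs ?_ ?_ ?_ ?_ ?_ ?_).2.differentiableAt
  · filter_upwards [hs] with w hw
    exact (integrable_mul_cauchyKernel hg
      (lt_trans (by simpa using hw) hρ)).aestronglyMeasurable
  · exact integrable_mul_cauchyKernel hg hz1
  · refine hg.aestronglyMeasurable.mul (Continuous.aestronglyMeasurable ?_)
    refine Continuous.div (by fun_prop) (by fun_prop) fun t => pow_ne_zero _ ?_
    exact one_sub_ne_zero_of_norm_lt (by rwa [norm_mul_exp_neg_I_mul])
  · refine Filter.Eventually.of_forall fun t w hw => ?_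
    have hw1 : ‖w‖ < ρ := by simpa using hw
    rw [norm_mul, norm_div, norm_exp_neg_I_mul, one_div, norm_pow, ← inv_pow]
    gcongr
    exact le_trans (by linarith) (one_sub_norm_le w t)
  · exact hg.norm.mul_const _
  · refine Filter.Eventually.of_forall fun t w hw => ?_
    have hw1 : ‖w‖ < 1 := lt_trans (by simpa using hw) hρ
    have hne := one_sub_ne_zero_of_norm_lt (z := w * Complex.exp (-(Complex.I * t)))
      (by rwa [norm_mul_exp_neg_I_mul])
    have := (((hasDerivAt_id w).mul_const (Complex.exp (-(Complex.I * t)))).const_sub 1).inv hne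
    exact (this.const_mul (g t)).congr_deriv (by simp)

theorem re_cauchyT {h : ℝ → ℝ} (hh : Integrable h muPi) {z : ℂ} (hz : ‖z‖ < 1) :
    (cauchyT (fun t => (h t : ℂ)) z).re =
      (2 * Real.pi)⁻¹ * ∫ t, h t * ((1 - z * Complex.exp (-(Complex.I * t)))⁻¹).re ∂muPi := by
  have h2 := integral_re (𝕜 := ℂ) (integrable_mul_cauchyKernel hh.ofReal hz)
  have e : (2 * (Real.pi : ℂ))⁻¹ = ((2 * Real.pi)⁻¹ : ℝ) := by push_cast; rfl
  simp only [RCLike.re_to_complex] at h2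
  rw [cauchyT, e, Complex.re_ofReal_mul]
  congr 1
  refine Eq.trans h2.symm (integral_congr_ae (Filter.Eventually.of_forall fun t => ?_))
  exact Complex.re_ofReal_mul _ _

theorem integrable_mul_re_cauchyKernel {h : ℝ → ℝ} (hh : Integrable h muPi) {z : ℂ}
    (hz : ‖z‖ < 1) :
    Integrable (fun t => h t * ((1 - z * Complex.exp (-(Complex.I * t)))⁻¹).re) muPi :=
  hh.mul_bdd (c := (1 - ‖z‖)⁻¹)
    (Complex.continuous_re.comp (continuous_cauchyKernel hz)).aestronglyMeasurable
    (Filter.Eventually.of_forall fun t =>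
      (Complex.abs_re_le_norm _).trans (norm_cauchyKernel_le hz t))

theorem re_cauchyT_pos {h : ℝ → ℝ} (hh : Integrable h muPi) (h0 : ∀ t, 0 ≤ h t)
    (hpos : 0 < ∫ t, h t ∂muPi) {z : ℂ} (hz : ‖z‖ < 1) :
    0 < (cauchyT (fun t => (h t : ℂ)) z).re := by
  rw [re_cauchyT hh hz]
  refine mul_pos (by positivity) (lt_of_lt_of_le (mul_pos hpos one_half_pos) ?_)
  rw [← integral_mul_const]
  refine integral_mono (hh.mul_const _) (integrable_mul_re_cauchyKernel hh hz) fun t => ?_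
  exact mul_le_mul_of_nonneg_left
    (half_le_re_inv_one_sub (by rwa [norm_mul_exp_neg_I_mul])) (h0 t)

theorem circleMap_mul_exp_neg (r x t : ℝ) :
    circleMap 0 r x * Complex.exp (-(Complex.I * t)) = circleMap 0 r (x - t) := by
  simp only [circleMap, zero_add]
  rw [mul_assoc, ← Complex.exp_add]
  congr 2
  push_cast
  ring

/-- The form of the real part to which the Schur test applies. -/
theorem ofReal_re_cauchyT {h : ℝ → ℝ} (hh : Integrable h muPi) (h0 : ∀ t, 0 ≤ h t) {r : ℝ}
    (hr0 : 0 ≤ r) (hr : r < 1) (x : ℝ) :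
    ENNReal.ofReal (cauchyT (fun t => (h t : ℂ)) (circleMap 0 r x)).re =
      ∫⁻ t, ENNReal.ofReal ((2 * Real.pi)⁻¹ * reCauchy r (x - t)) * ENNReal.ofReal (h t) ∂muPi := by
  have hk : ∀ y, 0 ≤ reCauchy r y := fun y => le_trans (by norm_num) (half_le_reCauchy hr0 hr y)
  have hz := norm_circleMap_lt hr0 hr x
  have e : (fun t => h t * ((1 - circleMap 0 r x * Complex.exp (-(Complex.I * t)))⁻¹).re) =
      fun t => h t * reCauchy r (x - t) := by
    funext t
    rw [circleMap_mul_exp_neg, reCauchy]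
  have hi := integrable_mul_re_cauchyKernel hh hz
  rw [e] at hi
  rw [re_cauchyT hh hz, e, ← integral_const_mul, ofReal_integral_eq_lintegral_ofReal
    (hi.const_mul _) (Filter.Eventually.of_forall fun t =>
      mul_nonneg (by positivity) (mul_nonneg (h0 t) (hk _)))]
  refine lintegral_congr fun t => ?_
  rw [← ENNReal.ofReal_mul (mul_nonneg (by positivity) (hk _))]
  congr 1
  ring

theorem continuous_cauchyT_circleMap {g : ℝ → ℂ} (hg : Integrable g muPi) {r : ℝ}
    (hr0 : 0 ≤ r) (hr : r < 1) : Continuous fun x => cauchyT g (circleMap 0 r x) :=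
  (differentiableOn_cauchyT hg).continuousOn.comp_continuous (continuous_circleMap 0 r)
    fun x => by simpa using norm_circleMap_lt hr0 hr x

/-! ### Riesz's bound for the Cauchy transform, `1 < p ≤ 2`. -/

theorem integral_norm_cauchyT_rpow_le {p : ℝ} (hp : 1 < p) (hp2 : p ≤ 2) {h : ℝ → ℝ}
    (hh : Integrable h muPi) (h0 : ∀ t, 0 ≤ h t) (hpos : 0 < ∫ t, h t ∂muPi) {r : ℝ}
    (hr0 : 0 ≤ r) (hr : r < 1) :
    ∫ x, ‖cauchyT (fun t => (h t : ℂ)) (circleMap 0 r x)‖ ^ p ∂muPi ≤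
      98 / (p - 1) * ∫ x, (cauchyT (fun t => (h t : ℂ)) (circleMap 0 r x)).re ^ p ∂muPi := by
  set F := cauchyT (fun t => (h t : ℂ)) with hF
  have hFre : ∀ z, ‖z‖ < 1 → 0 < (F z).re := fun z hz => re_cauchyT_pos hh h0 hpos hz
  have hcont : Continuous fun x => F (circleMap 0 r x) :=
    continuous_cauchyT_circleMap hh.ofReal hr0 hr
  have hdiff : DifferentiableOn ℂ (fun z => F z ^ (p : ℂ)) (Metric.ball 0 1) :=
    (differentiableOn_cauchyT hh.ofReal).cpow (differentiableOn_const _) fun z hz =>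
      Or.inl (hFre z (by simpa using hz))
  have hcp : Continuous fun x => F (circleMap 0 r x) ^ (p : ℂ) :=
    hdiff.continuousOn.comp_continuous (continuous_circleMap 0 r)
      fun x => by simpa using norm_circleMap_lt hr0 hr x
  have hmean := integral_muPi_circleMap hr0 hr hdiff
  -- By the mean value property this is `2π * F(0) ^ p`, and `F(0)` is the mean of `h`, a
  -- nonnegative real.
  have hre : 0 ≤ ∫ x, (F (circleMap 0 r x) ^ (p : ℂ)).re ∂muPi := by
    have h2 := integral_re (𝕜 := ℂ) hcp.integrable_muPi
    simp only [RCLike.re_to_complex] at h2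
    have e : F 0 = (((2 * Real.pi)⁻¹ * ∫ t, h t ∂muPi : ℝ) : ℂ) := by
      rw [hF, cauchyT_zero, integral_complex_ofReal]
      push_cast
      rfl
    have hm : 0 ≤ (2 * Real.pi)⁻¹ * ∫ t, h t ∂muPi := mul_nonneg (by positivity) hpos.le
    rw [h2, hmean, e, ← Complex.ofReal_cpow hm]
    have e3 : (2 * (Real.pi : ℂ)) = ((2 * Real.pi : ℝ) : ℂ) := by push_cast; rfl
    rw [e3, ← Complex.ofReal_mul, Complex.ofReal_re]
    positivity
  have hi1 : Integrable (fun x => (F (circleMap 0 r x)).re ^ p) muPi :=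
    ((Complex.continuous_re.comp hcont).rpow_const fun x =>
      Or.inr (by linarith)).integrable_muPi
  have hi2 : Integrable (fun x => (F (circleMap 0 r x) ^ (p : ℂ)).re) muPi :=
    (Complex.continuous_re.comp hcp).integrable_muPi
  have hi3 : Integrable (fun x => ‖F (circleMap 0 r x)‖ ^ p) muPi :=
    (hcont.norm.rpow_const fun x => Or.inr (by linarith)).integrable_muPi
  have hmono := integral_mono hi3 ((hi1.const_mul (98 / (p - 1))).sub
    (hi2.const_mul (2 / (p - 1)))) fun x =>
      norm_rpow_le_re_rpow_sub hp hp2 (hFre _ (norm_circleMap_lt hr0 hr x))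
  refine hmono.trans ?_
  simp only [Pi.sub_apply]
  rw [integral_sub (hi1.const_mul _) (hi2.const_mul _), integral_const_mul, integral_const_mul]
  have : 0 ≤ 2 / (p - 1) := div_nonneg two_pos.le (by linarith)
  linarith [mul_nonneg this hre]

theorem lintegral_ofReal_rpow {f : ℝ → ℝ} (hf : Continuous f) (h0 : ∀ x, 0 ≤ f x) {p : ℝ}
    (hp : 0 ≤ p) :
    ∫⁻ x, ENNReal.ofReal (f x) ^ p ∂muPi = ENNReal.ofReal (∫ x, f x ^ p ∂muPi) := by
  rw [ofReal_integral_eq_lintegral_ofReal (hf.rpow_const fun _ => Or.inr hp).integrable_muPi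
    (Filter.Eventually.of_forall fun x => Real.rpow_nonneg (h0 x) p)]
  exact lintegral_congr fun x => ENNReal.ofReal_rpow_of_nonneg (h0 x) hp

theorem eLpNorm_cauchyT_le_of_nonneg {p : ℝ} (hp : 1 < p) (hp2 : p ≤ 2) {h : ℝ → ℝ}
    (hh : Integrable h muPi) (h0 : ∀ t, 0 ≤ h t) {r : ℝ} (hr0 : 0 ≤ r) (hr : r < 1) :
    eLpNorm (fun x => cauchyT (fun t => (h t : ℂ)) (circleMap 0 r x)) (ENNReal.ofReal p) muPi ≤
      ENNReal.ofReal (98 / (p - 1)) * eLpNorm h (ENNReal.ofReal p) muPi := by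
  have hp0 : 0 < p := by linarith
  rcases (integral_nonneg h0 : 0 ≤ ∫ t, h t ∂muPi).eq_or_lt with hz | hpos
  -- If `h` vanishes almost everywhere, so does its transform; this case is separate because `F ^ p`
  -- needs `Re F > 0`.
  · have hae : h =ᵐ[muPi] 0 := (integral_eq_zero_iff_of_nonneg h0 hh).1 hz.symm
    have : (fun x => cauchyT (fun t => (h t : ℂ)) (circleMap 0 r x)) = 0 := by
      funext x
      rw [cauchyT, integral_eq_zero_of_ae]
      · simp
      · filter_upwards [hae] with t ht
        simp [ht]
    rw [this, eLpNorm_zero]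
    exact zero_le
  · have hhc : Integrable (fun t => (h t : ℂ)) muPi := hh.ofReal
    have hcont := continuous_cauchyT_circleMap hhc hr0 hr
    have hcre : Continuous fun x => (cauchyT (fun t => (h t : ℂ)) (circleMap 0 r x)).re :=
      Complex.continuous_re.comp hcont
    have key := ENNReal.ofReal_le_ofReal
      (integral_norm_cauchyT_rpow_le hp hp2 hh h0 hpos hr0 hr)
    -- Taking `p`-th roots leaves the constant to the power `1 / p`, which is at most the constant
    -- itself since it is at least one.
    have hA : 1 ≤ 98 / (p - 1) := by rw [le_div_iff₀] <;> linarith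
    rw [ENNReal.ofReal_mul (by linarith), ← lintegral_ofReal_rpow hcont.norm
      (fun _ => norm_nonneg _) hp0.le, ← lintegral_ofReal_rpow hcre
      (fun x => (re_cauchyT_pos hh h0 hpos (norm_circleMap_lt hr0 hr x)).le) hp0.le] at key
    simp_rw [ofReal_re_cauchyT hh h0 hr0 hr, ofReal_norm] at key
    have key2 := key.trans (mul_le_mul_right (lintegral_reCauchy_conv_rpow_le hr0 hr hp
      hh.aestronglyMeasurable.aemeasurable.ennreal_ofReal) _)
    rw [eLpNorm_eq_lintegral_rpow_enorm_toReal (by simpa using hp0) ENNReal.ofReal_ne_top,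
      eLpNorm_eq_lintegral_rpow_enorm_toReal (by simpa using hp0) ENNReal.ofReal_ne_top,
      ENNReal.toReal_ofReal hp0.le]
    simp_rw [Real.enorm_of_nonneg (h0 _)]
    refine (ENNReal.rpow_le_rpow key2 (by positivity : 0 ≤ 1 / p)).trans ?_
    rw [ENNReal.mul_rpow_of_nonneg _ _ (by positivity)]
    gcongr
    refine (ENNReal.rpow_le_rpow_of_exponent_le (by simpa using hA)
      ((div_le_one hp0).2 hp.le)).trans_eq (ENNReal.rpow_one _)

theorem integrable_of_memLp {E : Type*} [NormedAddCommGroup E] {p : ℝ} (hp : 1 < p) {g : ℝ → E}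
    (hg : MemLp g (ENNReal.ofReal p) muPi) : Integrable g muPi :=
  hg.integrable (by simpa using hp.le)

/-- Positive and negative parts of the real and imaginary parts are each dominated by `‖g‖`, whence
`392 = 4 * 98`. -/
theorem eLpNorm_cauchyT_le {p : ℝ} (hp : 1 < p) (hp2 : p ≤ 2) {g : ℝ → ℂ}
    (hg : Integrable g muPi) {r : ℝ} (hr0 : 0 ≤ r) (hr : r < 1) :
    eLpNorm (fun x => cauchyT g (circleMap 0 r x)) (ENNReal.ofReal p) muPi ≤
      ENNReal.ofReal (392 / (p - 1)) * eLpNorm g (ENNReal.ofReal p) muPi := by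
  have hp1 : 1 ≤ ENNReal.ofReal p := by simpa using hp.le
  have piece : ∀ (c : ℂ) (h : ℝ → ℝ), ‖c‖ = 1 → Integrable h muPi → (∀ t, 0 ≤ h t) →
      (∀ t, h t ≤ ‖g t‖) →
      AEStronglyMeasurable (fun x => c * cauchyT (fun t => (h t : ℂ)) (circleMap 0 r x)) muPi ∧
      eLpNorm (fun x => c * cauchyT (fun t => (h t : ℂ)) (circleMap 0 r x)) (ENNReal.ofReal p) muPi
        ≤ ENNReal.ofReal (98 / (p - 1)) * eLpNorm g (ENNReal.ofReal p) muPi := by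
    intro c h hc hh h0 hle
    refine ⟨((continuous_cauchyT_circleMap hh.ofReal hr0 hr).const_mul c).aestronglyMeasurable, ?_⟩
    calc _ ≤ eLpNorm (fun x => cauchyT (fun t => (h t : ℂ)) (circleMap 0 r x))
          (ENNReal.ofReal p) muPi := eLpNorm_mono fun x => by rw [norm_mul, hc, one_mul]
      _ ≤ ENNReal.ofReal (98 / (p - 1)) * eLpNorm h (ENNReal.ofReal p) muPi :=
        eLpNorm_cauchyT_le_of_nonneg hp hp2 hh h0 hr0 hr
      _ ≤ _ := by
        gcongr
        exact eLpNorm_mono fun t => by rw [Real.norm_of_nonneg (h0 t)]; exact hle t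
  have hre : Integrable (fun t => (g t).re) muPi := hg.re
  have him : Integrable (fun t => (g t).im) muPi := hg.im
  have i1 : Integrable (fun t => max (g t).re 0) muPi := hre.pos_part
  have i2 : Integrable (fun t => max (-(g t).re) 0) muPi := hre.neg_part
  have i3 : Integrable (fun t => max (g t).im 0) muPi := him.pos_part
  have i4 : Integrable (fun t => max (-(g t).im) 0) muPi := him.neg_part
  obtain ⟨m1, n1⟩ := piece 1 _ (by simp) i1 (fun t => le_max_right _ _)
    (fun t => max_le ((le_abs_self _).trans (Complex.abs_re_le_norm _)) (norm_nonneg _))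
  obtain ⟨m2, n2⟩ := piece (-1) _ (by simp) i2 (fun t => le_max_right _ _)
    (fun t => max_le ((neg_le_abs _).trans (Complex.abs_re_le_norm _)) (norm_nonneg _))
  obtain ⟨m3, n3⟩ := piece Complex.I _ (by simp) i3 (fun t => le_max_right _ _)
    (fun t => max_le ((le_abs_self _).trans (Complex.abs_im_le_norm _)) (norm_nonneg _))
  obtain ⟨m4, n4⟩ := piece (-Complex.I) _ (by simp) i4 (fun t => le_max_right _ _)
    (fun t => max_le ((neg_le_abs _).trans (Complex.abs_im_le_norm _)) (norm_nonneg _))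
  have max_sub : ∀ a : ℝ, max a 0 - max (-a) 0 = a := fun a => by
    rcases le_total a 0 with h | h
    · rw [max_eq_right h, max_eq_left (by linarith)]; ring
    · rw [max_eq_left h, max_eq_right (by linarith)]; ring
  have hdec : g = fun t => ((1 * ((max (g t).re 0 : ℝ) : ℂ) + -1 * ((max (-(g t).re) 0 : ℝ) : ℂ)) +
      (Complex.I * ((max (g t).im 0 : ℝ) : ℂ) + -Complex.I * ((max (-(g t).im) 0 : ℝ) : ℂ))) := by
    funext t
    apply Complex.ext
    · simpa [sub_eq_add_neg] using (max_sub (g t).re).symm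
    · simpa [sub_eq_add_neg] using (max_sub (g t).im).symm
  have i1c : Integrable (fun t => ((max (g t).re 0 : ℝ) : ℂ)) muPi := i1.ofReal
  have i2c : Integrable (fun t => ((max (-(g t).re) 0 : ℝ) : ℂ)) muPi := i2.ofReal
  have i3c : Integrable (fun t => ((max (g t).im 0 : ℝ) : ℂ)) muPi := i3.ofReal
  have i4c : Integrable (fun t => ((max (-(g t).im) 0 : ℝ) : ℂ)) muPi := i4.ofReal
  have i12 : Integrable (fun t => 1 * ((max (g t).re 0 : ℝ) : ℂ) +
      -1 * ((max (-(g t).re) 0 : ℝ) : ℂ)) muPi := (i1c.const_mul _).add (i2c.const_mul _)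
  have i34 : Integrable (fun t => Complex.I * ((max (g t).im 0 : ℝ) : ℂ) +
      -Complex.I * ((max (-(g t).im) 0 : ℝ) : ℂ)) muPi := (i3c.const_mul _).add (i4c.const_mul _)
  have hT : (fun x => cauchyT g (circleMap 0 r x)) =
      ((fun x => 1 * cauchyT (fun t => ((max (g t).re 0 : ℝ) : ℂ)) (circleMap 0 r x)) +
        fun x => -1 * cauchyT (fun t => ((max (-(g t).re) 0 : ℝ) : ℂ)) (circleMap 0 r x)) +
      ((fun x => Complex.I * cauchyT (fun t => ((max (g t).im 0 : ℝ) : ℂ)) (circleMap 0 r x)) +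
        fun x => -Complex.I *
          cauchyT (fun t => ((max (-(g t).im) 0 : ℝ) : ℂ)) (circleMap 0 r x)) := by
    funext x
    have hz := norm_circleMap_lt hr0 hr x
    conv_lhs => rw [hdec]
    rw [cauchyT_add i12 i34 hz,
      cauchyT_add (i1c.const_mul _) (i2c.const_mul _) hz,
      cauchyT_add (i3c.const_mul _) (i4c.const_mul _) hz]
    simp only [cauchyT_const_mul, Pi.add_apply]
  rw [hT]
  refine (eLpNorm_add_le (m1.add m2) (m3.add m4) hp1).trans ?_
  refine (add_le_add ((eLpNorm_add_le m1 m2 hp1).trans (add_le_add n1 n2))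
    ((eLpNorm_add_le m3 m4 hp1).trans (add_le_add n3 n4))).trans (le_of_eq ?_)
  have e : ENNReal.ofReal (392 / (p - 1)) = 4 * ENNReal.ofReal (98 / (p - 1)) := by
    rw [← ENNReal.ofReal_ofNat, ← ENNReal.ofReal_mul (by norm_num)]
    congr 1
    ring
  rw [e]
  ring

/-! ### Partial sums through two Cauchy transforms. -/

/-- The Fourier partial sum with the Abel-type damping factors `r ^ (M - n)`. -/
def dampedSum (M : ℕ) (f : ℝ → ℝ) (r x : ℝ) : ℂ :=
  (2 * (Real.pi : ℂ))⁻¹ * ∑ m ∈ Finset.range (2 * M + 1),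
    (r : ℂ) ^ m * (fourierC f (M - m) * Complex.exp (-(Complex.I * ((M - m : ℤ) : ℂ) * x)))

theorem dampedSum_one (M : ℕ) (f : ℝ → ℝ) (x : ℝ) : dampedSum M f 1 x = fourierSumC M f x := by
  unfold dampedSum fourierSumC
  congr 1
  refine Finset.sum_nbij' (fun m => (M : ℤ) - m) (fun n => ((M : ℤ) - n).toNat) ?_ ?_ ?_ ?_ ?_
  · intro m hm
    rw [Finset.mem_range] at hm
    rw [Finset.mem_Icc]
    omega
  · intro n hn
    rw [Finset.mem_Icc] at hn
    rw [Finset.mem_range]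
    omega
  · intro m hm
    simp
  · intro n hn
    rw [Finset.mem_Icc] at hn
    omega
  · intro m hm
    simp

theorem continuous_dampedSum (M : ℕ) (f : ℝ → ℝ) (x : ℝ) :
    Continuous fun r => dampedSum M f r x := by
  unfold dampedSum
  fun_prop

theorem continuous_dampedSum_right (M : ℕ) (f : ℝ → ℝ) (r : ℝ) :
    Continuous (dampedSum M f r) := by
  unfold dampedSum
  fun_prop

theorem integrable_exp_mul {f : ℝ → ℝ} (hf : Integrable f muPi) (n : ℤ) :
    Integrable (fun t : ℝ => Complex.exp (Complex.I * n * t) * (f t : ℂ)) muPi := by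
  refine hf.ofReal.bdd_mul (c := 1) (Continuous.aestronglyMeasurable (by fun_prop))
    (Filter.Eventually.of_forall fun t => ?_)
  rw [Complex.norm_exp]
  simp

theorem norm_exp_I_mul (n : ℤ) (t : ℝ) : ‖Complex.exp (Complex.I * n * t)‖ = 1 := by
  rw [Complex.norm_exp]
  simp

theorem cauchyKernel_sub_eq_sum {z : ℂ} (hz : ‖z‖ < 1) (M : ℕ) (f : ℝ → ℝ) (t : ℝ) :
    Complex.exp (Complex.I * (M : ℤ) * t) * (f t : ℂ) *
        (1 - z * Complex.exp (-(Complex.I * t)))⁻¹ -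
      z ^ (2 * M + 1) * (Complex.exp (Complex.I * (-(M + 1 : ℤ) : ℤ) * t) * (f t : ℂ) *
        (1 - z * Complex.exp (-(Complex.I * t)))⁻¹) =
      ∑ m ∈ Finset.range (2 * M + 1),
        z ^ m * (Complex.exp (Complex.I * (M - m : ℤ) * t) * (f t : ℂ)) := by
  have hpow : ∀ m : ℕ, Complex.exp (Complex.I * (M - m : ℤ) * t) =
      Complex.exp (Complex.I * (M : ℤ) * t) * Complex.exp (-(Complex.I * t)) ^ m := fun m => by
    rw [← Complex.exp_nat_mul, ← Complex.exp_add]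
    congr 1
    push_cast
    ring
  -- The frequencies `M, M - 1, …, -M` number `2 * M + 1`, so the subtracted tail of the geometric
  -- series starts at `-(M + 1)`.
  have e1 : (-(M + 1 : ℤ) : ℤ) = M - (2 * M + 1 : ℕ) := by push_cast; ring
  rw [e1]
  simp_rw [hpow]
  have hne := one_sub_ne_zero_of_norm_lt (z := z * Complex.exp (-(Complex.I * t)))
    (by rwa [norm_mul_exp_neg_I_mul])
  set E := Complex.exp (-(Complex.I * t))
  set G := Complex.exp (Complex.I * (M : ℤ) * t)
  have hgeom := mul_neg_geom_sum (z * E) (2 * M + 1)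
  have hsum : ∑ m ∈ Finset.range (2 * M + 1), z ^ m * (G * E ^ m * (f t : ℂ)) =
      G * f t * ∑ m ∈ Finset.range (2 * M + 1), (z * E) ^ m := by
    rw [Finset.mul_sum]
    exact Finset.sum_congr rfl fun m _ => by rw [mul_pow]; ring
  rw [hsum, ← eq_inv_mul_iff_mul_eq₀ hne] at *
  rw [hgeom, mul_pow]
  ring

theorem dampedSum_eq {f : ℝ → ℝ} (hf : Integrable f muPi) (M : ℕ) {r : ℝ} (hr0 : 0 ≤ r)
    (hr : r < 1) (x : ℝ) :
    dampedSum M f r x = Complex.exp (Complex.I * (-M : ℤ) * x) *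
      (cauchyT (fun t => Complex.exp (Complex.I * (M : ℤ) * t) * (f t : ℂ)) (circleMap 0 r x) -
        circleMap 0 r x ^ (2 * M + 1) *
          cauchyT (fun t => Complex.exp (Complex.I * (-(M + 1 : ℤ) : ℤ) * t) * (f t : ℂ))
            (circleMap 0 r x)) := by
  have hz := norm_circleMap_lt hr0 hr x
  have h1 := integrable_mul_cauchyKernel (integrable_exp_mul hf M) hz
  have h2 := integrable_mul_cauchyKernel (integrable_exp_mul hf (-(M + 1 : ℤ))) hz
  have hI := integral_sub h1 (h2.const_mul (circleMap 0 r x ^ (2 * M + 1)))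
  simp_rw [cauchyKernel_sub_eq_sum hz] at hI
  rw [integral_finsetSum _ fun m _ => (integrable_exp_mul hf _).const_mul _] at hI
  simp_rw [integral_const_mul] at hI
  unfold cauchyT
  rw [mul_left_comm (circleMap 0 r x ^ (2 * M + 1)), ← mul_sub, ← hI, dampedSum, mul_left_comm]
  congr 1
  rw [Finset.mul_sum]
  refine Finset.sum_congr rfl fun m _ => ?_
  have e : Complex.exp (Complex.I * (-M : ℤ) * x) * circleMap 0 r x ^ m =
      (r : ℂ) ^ m * Complex.exp (-(Complex.I * ((M - m : ℤ) : ℂ) * x)) := by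
    rw [circleMap, zero_add, mul_pow, mul_left_comm, ← Complex.exp_nat_mul, ← Complex.exp_add]
    congr 2
    push_cast
    ring
  unfold fourierC
  linear_combination (-∫ t, Complex.exp (Complex.I * (M - m : ℤ) * t) * (f t : ℂ) ∂muPi) * e

/-- The modulations have modulus one and the power of `circleMap 0 r x` at most one, so the two
transforms cost `784 = 2 * 392`, whatever `M` and `r`. -/
theorem eLpNorm_dampedSum_le {p : ℝ} (hp : 1 < p) (hp2 : p ≤ 2) {f : ℝ → ℝ}
    (hf : Integrable f muPi) (M : ℕ) {r : ℝ} (hr0 : 0 ≤ r) (hr : r < 1) :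
    eLpNorm (dampedSum M f r) (ENNReal.ofReal p) muPi ≤
      ENNReal.ofReal (784 / (p - 1)) * eLpNorm f (ENNReal.ofReal p) muPi := by
  have hp1 : 1 ≤ ENNReal.ofReal p := by simpa using hp.le
  have hT : ∀ n : ℤ, eLpNorm (fun x => cauchyT (fun t : ℝ => Complex.exp (Complex.I * n * t) *
      (f t : ℂ)) (circleMap 0 r x)) (ENNReal.ofReal p) muPi ≤
      ENNReal.ofReal (392 / (p - 1)) * eLpNorm f (ENNReal.ofReal p) muPi := fun n => by
    refine (eLpNorm_cauchyT_le hp hp2 (integrable_exp_mul hf n) hr0 hr).trans_eq ?_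
    congr 1
    exact eLpNorm_congr_norm_ae (Filter.Eventually.of_forall fun t => by
      rw [norm_mul, norm_exp_I_mul, one_mul, Complex.norm_real])
  have hc : ∀ n : ℤ, AEStronglyMeasurable (fun x => ‖cauchyT (fun t : ℝ =>
      Complex.exp (Complex.I * n * t) * (f t : ℂ)) (circleMap 0 r x)‖) muPi := fun n =>
    (continuous_cauchyT_circleMap (integrable_exp_mul hf n) hr0 hr).norm.aestronglyMeasurable
  calc _ ≤ eLpNorm ((fun x => ‖cauchyT (fun t : ℝ => Complex.exp (Complex.I * (M : ℤ) * t) *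
            (f t : ℂ)) (circleMap 0 r x)‖) +
          fun x => ‖cauchyT (fun t : ℝ => Complex.exp (Complex.I * (-(M + 1 : ℤ) : ℤ) * t) *
            (f t : ℂ)) (circleMap 0 r x)‖) (ENNReal.ofReal p) muPi := by
        refine eLpNorm_mono_real fun x => ?_
        rw [dampedSum_eq hf M hr0 hr, norm_mul, norm_exp_I_mul, one_mul]
        refine (norm_sub_le _ _).trans (add_le_add le_rfl ?_)
        rw [norm_mul, norm_pow]
        exact mul_le_of_le_one_left (norm_nonneg _)
          (pow_le_one₀ (norm_nonneg _) (norm_circleMap_lt hr0 hr x).le)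
    _ ≤ _ := eLpNorm_add_le (hc _) (hc _) hp1
    _ ≤ _ := by
        rw [eLpNorm_norm, eLpNorm_norm]
        refine (add_le_add (hT _) (hT _)).trans_eq ?_
        rw [← add_mul, ← ENNReal.ofReal_add] <;> try exact div_nonneg (by norm_num) (by linarith)
        congr 2
        ring

theorem eLpNorm_fourierSum_le_of_le_two {p : ℝ} (hp : 1 < p) (hp2 : p ≤ 2) {f : ℝ → ℝ}
    (hf : Integrable f muPi) (M : ℕ) :
    eLpNorm (fourierSum M f) (ENNReal.ofReal p) muPi ≤
      ENNReal.ofReal (784 / (p - 1)) * eLpNorm f (ENNReal.ofReal p) muPi := by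
  let r : ℕ → ℝ := fun k => 1 - 1 / ((k : ℝ) + 1)
  have hr0 : ∀ k, 0 ≤ r k := fun k => by
    have : 1 / ((k : ℝ) + 1) ≤ 1 := by
      rw [div_le_one (by positivity)]
      linarith [(Nat.cast_nonneg k : (0 : ℝ) ≤ k)]
    simp only [r]
    linarith
  have hr1 : ∀ k, r k < 1 := fun k => by
    have : 0 < 1 / ((k : ℝ) + 1) := by positivity
    simp only [r]
    linarith
  have hlim : Filter.Tendsto r Filter.atTop (nhds 1) := by
    simpa [r] using tendsto_one_div_add_atTop_nhds_zero_nat.const_sub (1 : ℝ)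
  calc _ ≤ eLpNorm (fourierSumC M f) (ENNReal.ofReal p) muPi :=
        eLpNorm_mono fun x => Complex.abs_re_le_norm _
    _ ≤ Filter.atTop.liminf fun k => eLpNorm (dampedSum M f (r k)) (ENNReal.ofReal p) muPi := by
        -- Fatou's lemma along `r k → 1`: the damped sums are polynomials in `r`, hence converge
        -- pointwise.
        refine Lp.eLpNorm_lim_le_liminf_eLpNorm
          (fun k => (continuous_dampedSum_right M f (r k)).aestronglyMeasurable) _
          (Filter.Eventually.of_forall fun x => ?_)
        rw [← dampedSum_one]
        exact ((continuous_dampedSum M f x).tendsto 1).comp hlim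
    _ ≤ _ := by
        refine Filter.liminf_le_of_frequently_le' (Filter.Frequently.of_forall fun k => ?_)
        exact eLpNorm_dampedSum_le hp hp2 hf M (hr0 k) (hr1 k)

/-! ### Duality for `p > 2`. -/

theorem continuous_fourierSum (M : ℕ) (f : ℝ → ℝ) : Continuous (fourierSum M f) := by
  unfold fourierSum fourierSumC
  fun_prop

theorem integral_fourierSum_mul (M : ℕ) (f : ℝ → ℝ) {g : ℝ → ℝ} (hg : Integrable g muPi) :
    ((∫ x, fourierSum M f x * g x ∂muPi : ℝ) : ℂ) =
      (2 * (Real.pi : ℂ))⁻¹ * ∑ n ∈ Finset.Icc (-(M : ℤ)) (M : ℤ),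
        fourierC f n * fourierC g (-n) := by
  have hpt : ∀ x, ((fourierSum M f x * g x : ℝ) : ℂ) = (2 * (Real.pi : ℂ))⁻¹ *
      ∑ n ∈ Finset.Icc (-(M : ℤ)) (M : ℤ),
        fourierC f n * (Complex.exp (Complex.I * (-n : ℤ) * x) * (g x : ℂ)) := fun x => by
    rw [Complex.ofReal_mul, fourierSum_eq, fourierSumC, mul_assoc, Finset.sum_mul]
    congr 1
    refine Finset.sum_congr rfl fun n _ => ?_
    rw [mul_assoc]
    congr 3
    push_cast
    ring
  rw [← integral_complex_ofReal]
  simp_rw [hpt]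
  rw [integral_const_mul, integral_finsetSum _ fun n _ => (integrable_exp_mul hg _).const_mul _]
  simp_rw [integral_const_mul]
  rfl

/-- The partial sum operators are symmetric. -/
theorem integral_fourierSum_mul_comm (M : ℕ) {f g : ℝ → ℝ} (hf : Integrable f muPi)
    (hg : Integrable g muPi) :
    ∫ x, fourierSum M f x * g x ∂muPi = ∫ x, f x * fourierSum M g x ∂muPi := by
  simp_rw [mul_comm (f _)]
  rw [← Complex.ofReal_inj, integral_fourierSum_mul M f hg, integral_fourierSum_mul M g hf]
  congr 1
  refine Finset.sum_nbij' (fun n => -n) (fun n => -n) ?_ ?_ ?_ ?_ ?_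
  · intro n hn
    rw [Finset.mem_Icc] at hn ⊢
    omega
  · intro n hn
    rw [Finset.mem_Icc] at hn ⊢
    omega
  · intro n _
    simp
  · intro n _
    simp
  · intro n _
    rw [neg_neg, mul_comm]

theorem _root_.Continuous.lintegral_enorm_rpow_lt_top_muPi {f : ℝ → ℝ} (hf : Continuous f) {p : ℝ}
    (hp : 0 ≤ p) : ∫⁻ x, ‖f x‖ₑ ^ p ∂muPi < ∞ := by
  have h := lintegral_ofReal_rpow hf.norm (fun _ => norm_nonneg _) hp
  simp_rw [ofReal_norm] at h
  rw [h]
  exact ENNReal.ofReal_lt_top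

theorem eLpNorm_fourierSum_le_of_two_lt {p : ℝ} (hp : 2 < p) {f : ℝ → ℝ}
    (hf : Integrable f muPi) (M : ℕ) :
    eLpNorm (fourierSum M f) (ENNReal.ofReal p) muPi ≤
      ENNReal.ofReal (784 * (p - 1)) * eLpNorm f (ENNReal.ofReal p) muPi := by
  have hp0 : 0 < p := by linarith
  have hpq := Real.HolderConjugate.conjExponent (by linarith : 1 < p)
  set q := p.conjExponent with hq
  have hq1 : 1 < q := hpq.symm.lt
  have hq0 : 0 < q := by linarith
  have hqp : q * (p - 1) = p := by rw [mul_comm, hpq.sub_one_mul_conj]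
  have hq2 : q ≤ 2 := by nlinarith
  -- For conjugate exponents `(p - 1) * (q - 1) = 1`: the blow-up at `q → 1` becomes linear growth
  -- in `p`.
  have hK : 784 / (q - 1) = 784 * (p - 1) := by
    have h1 : (q - 1) * (p - 1) = 1 := by linarith
    have h2 : q - 1 ≠ 0 := by linarith
    field_simp
    linarith
  set u := fourierSum M f with hu
  have hucont : Continuous u := continuous_fourierSum M f
  -- The extremal function in Hölder's inequality: `u * g = |u| ^ p = |g| ^ q`.
  set g : ℝ → ℝ := fun x => |u x| ^ (p - 2) * u x with hg
  have hgcont : Continuous g :=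
    (hucont.abs.rpow_const fun x => Or.inr (by linarith)).mul hucont
  have hug : ∀ x, u x * g x = |u x| ^ p := fun x => by
    rcases eq_or_ne (u x) 0 with h | h
    · simp [hg, h, hp0.ne']
    · have : |u x| ^ p = |u x| ^ (p - 2) * |u x| ^ (2 : ℕ) := by
        rw [← Real.rpow_natCast, ← Real.rpow_add (abs_pos.2 h)]
        norm_num
      rw [this, sq_abs]
      simp only [hg]
      ring
  have hgq : ∀ x, ‖g x‖ₑ ^ q = ‖u x‖ₑ ^ p := fun x => by
    have : ‖g x‖ = ‖u x‖ ^ (p - 1) := by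
      rcases eq_or_ne (u x) 0 with h | h
      · simp [hg, h, Real.zero_rpow (by linarith : p - 1 ≠ 0)]
      · have e : |u x| ^ (p - 1) = |u x| ^ (p - 2) * |u x| := by
          rw [← Real.rpow_add_one (abs_ne_zero.2 h)]
          congr 1
          ring
        rw [Real.norm_eq_abs, Real.norm_eq_abs, e, hg, abs_mul,
          abs_of_nonneg (Real.rpow_nonneg (abs_nonneg _) _)]
    rw [← ofReal_norm, this, ← ENNReal.ofReal_rpow_of_nonneg (norm_nonneg _) (by linarith),
      ofReal_norm, ← ENNReal.rpow_mul, mul_comm, hqp]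
  set J := ∫⁻ x, ‖u x‖ₑ ^ p ∂muPi with hJ
  -- Finite because `u` is a trigonometric polynomial; this permits cancelling `J ^ (1 / q)` at the
  -- end.
  have hJtop : J ≠ ∞ := (hucont.lintegral_enorm_rpow_lt_top_muPi hp0.le).ne
  have hnorm : ∀ {s : ℝ} (_ : 0 < s) (v : ℝ → ℝ), eLpNorm v (ENNReal.ofReal s) muPi =
      (∫⁻ x, ‖v x‖ₑ ^ s ∂muPi) ^ (1 / s) := fun {s} hs v => by
    rw [eLpNorm_eq_lintegral_rpow_enorm_toReal (by simpa using hs) ENNReal.ofReal_ne_top,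
      ENNReal.toReal_ofReal hs.le]
  have hdual : J ≤ eLpNorm f (ENNReal.ofReal p) muPi *
      eLpNorm (fourierSum M g) (ENNReal.ofReal q) muPi := by
    have e1 : J = ‖∫ x, f x * fourierSum M g x ∂muPi‖ₑ := by
      rw [← integral_fourierSum_mul_comm M hf hgcont.integrable_muPi]
      simp_rw [← hu, hug]
      rw [Real.enorm_of_nonneg (integral_nonneg fun x => Real.rpow_nonneg (abs_nonneg _) _),
        ← lintegral_ofReal_rpow hucont.abs (fun _ => abs_nonneg _) hp0.le]
      simp_rw [hJ, Real.enorm_eq_ofReal_abs]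
    rw [e1, hnorm hp0, hnorm hq0]
    refine (enorm_integral_le_lintegral_enorm _).trans ?_
    simp_rw [enorm_mul]
    exact ENNReal.lintegral_mul_le_Lp_mul_Lq muPi hpq hf.aestronglyMeasurable.aemeasurable.enorm
      (continuous_fourierSum M g).measurable.enorm.aemeasurable
  have hsg := eLpNorm_fourierSum_le_of_le_two hq1 hq2 hgcont.integrable_muPi M
  rw [hK, hnorm hq0 g] at hsg
  simp_rw [hgq] at hsg
  rw [← hJ] at hsg
  rw [hnorm hp0 u, ← hJ]
  rcases eq_or_ne J 0 with h0 | h0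
  · rw [h0, ENNReal.zero_rpow_of_pos (by positivity)]
    exact zero_le
  have hJq0 : J ^ (1 / q) ≠ 0 := by simp [ENNReal.rpow_eq_zero_iff, h0, hJtop]
  have hJqtop : J ^ (1 / q) ≠ ∞ := ENNReal.rpow_ne_top_of_nonneg (by positivity) hJtop
  rw [← ENNReal.mul_le_mul_iff_left hJq0 hJqtop, ← ENNReal.rpow_add _ _ h0 hJtop]
  have e : 1 / p + 1 / q = 1 := by simpa using hpq.inv_add_inv_eq_one
  rw [e, ENNReal.rpow_one]
  calc J ≤ _ := hdual
    _ ≤ _ := mul_le_mul_right hsg _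
    _ = _ := by ring

/-! ### From `L^p` bounds to the `G(ψ)` norms. -/

theorem eLpNorm_fourierSum_le {p : ℝ} (hp : 1 < p) {f : ℝ → ℝ} (hf : Integrable f muPi) (M : ℕ) :
    eLpNorm (fourierSum M f) (ENNReal.ofReal p) muPi ≤
      784 * ENNReal.ofReal (p ^ 2 / (p - 1)) * eLpNorm f (ENNReal.ofReal p) muPi := by
  have hp1 : 0 < p - 1 := by linarith
  rw [← ENNReal.ofReal_ofNat, ← ENNReal.ofReal_mul (by norm_num)]
  rcases le_or_gt p 2 with h | h
  · refine (eLpNorm_fourierSum_le_of_le_two hp h hf M).trans ?_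
    gcongr
    rw [← mul_div_assoc]
    gcongr
    nlinarith
  · refine (eLpNorm_fourierSum_le_of_two_lt h hf M).trans ?_
    gcongr
    rw [le_div_iff₀ hp1]
    nlinarith

theorem IsUPsi.mem_psiSupp_iff {a : ℝ} {b : EReal} {ψ : ℝ → ℝ≥0∞} (hψ : IsUPsi a b ψ)
    (hsupp : Ioi (1 : ℝ) ⊆ psiSupp ψ) (p : ℝ) : p ∈ psiSupp ψ ↔ 1 < p := by
  refine ⟨fun h => ?_, fun h => hsupp h⟩
  rw [hψ.psiSupp_eq] at h
  exact lt_of_le_of_lt hψ.one_le h.1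

theorem gOpNorm_fourierSum_le {a : ℝ} {b : EReal} {ψ : ℝ → ℝ≥0∞} (hψ : IsUPsi a b ψ)
    (hsupp : Ioi (1 : ℝ) ⊆ psiSupp ψ) (M : ℕ) :
    gOpNorm ψ (psiLG 1 1 ψ) muPi (fourierSum M) ≤ 784 := by
  refine sInf_le fun f hf => ?_
  have hmem := hψ.mem_psiSupp_iff hsupp
  have hpos : ∀ p, 1 < p → ψ p ≠ 0 := fun p hp =>
    (hψ.pos p (hψ.psiSupp_eq ▸ (hmem p).2 hp)).ne'
  have hfin : ∀ p, 1 < p → ψ p ≠ ∞ := fun p hp => ne_of_lt ((hmem p).2 hp)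
  have hle : ∀ p, 1 < p → eLpNorm f (ENNReal.ofReal p) muPi / ψ p ≤ gNorm ψ muPi f :=
    fun p hp => le_iSup₂ (f := fun p _ => eLpNorm f (ENNReal.ofReal p) muPi / ψ p) p
      ((hmem p).2 hp)
  have hint : Integrable f muPi := by
    -- Any exponent above one would do: finiteness of `ψ 2` puts `f` in `L^2`, hence in `L^1` on the
    -- finite measure space.
    refine integrable_of_memLp one_lt_two ⟨hf.1, ?_⟩
    have hc : eLpNorm f (ENNReal.ofReal 2) muPi =
        eLpNorm f (ENNReal.ofReal 2) muPi / ψ 2 * ψ 2 :=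
      (ENNReal.div_mul_cancel (hpos 2 one_lt_two) (hfin 2 one_lt_two)).symm
    rw [hc]
    exact ENNReal.mul_lt_top (lt_of_le_of_lt (hle 2 one_lt_two) hf.2)
      (lt_top_iff_ne_top.2 (hfin 2 one_lt_two))
  have hbound : gNorm (psiLG 1 1 ψ) muPi (fourierSum M f) ≤ 784 * gNorm ψ muPi f := by
    refine iSup₂_le fun p hp => ?_
    have hp1 : 1 < p := by
      by_contra h
      simp [psiSupp, psiLG, h] at hp
    have hp0 : 0 < p - 1 := by linarith
    have e : p ^ ((1 : ℝ) + 1) * (p - 1) ^ (-(1 : ℝ)) = p ^ 2 / (p - 1) := by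
      rw [Real.rpow_neg_one, one_add_one_eq_two, Real.rpow_two, div_eq_mul_inv]
    have hw : ENNReal.ofReal (p ^ 2 / (p - 1)) ≠ 0 := by
      rw [Ne, ENNReal.ofReal_eq_zero, not_le]
      positivity
    simp only [psiLG, if_pos hp1, e]
    calc _ ≤ 784 * ENNReal.ofReal (p ^ 2 / (p - 1)) * eLpNorm f (ENNReal.ofReal p) muPi /
          (ENNReal.ofReal (p ^ 2 / (p - 1)) * ψ p) :=
        ENNReal.div_le_div_right (eLpNorm_fourierSum_le hp1 hint M) _
      _ = 784 * (eLpNorm f (ENNReal.ofReal p) muPi / ψ p) := by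
        rw [mul_comm 784, mul_assoc,
          ENNReal.mul_div_mul_left _ _ hw ENNReal.ofReal_ne_top, mul_div_assoc]
      _ ≤ _ := mul_le_mul_right (hle p hp1) _
  exact ⟨⟨(continuous_fourierSum M f).aestronglyMeasurable,
    lt_of_le_of_lt hbound (ENNReal.mul_lt_top (by simp) hf.2)⟩, hbound⟩

end GPsi
end

theorem theorem10 (a : ℝ) (b : EReal) (ψ : ℝ → ℝ≥0∞) (hψ : GPsi.IsUPsi a b ψ)
    (hsupp : Set.Ioi (1 : ℝ) ⊆ GPsi.psiSupp ψ) :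
    (⨆ (M : ℕ) (_ : 1 ≤ M),
      GPsi.gOpNorm ψ (GPsi.psiLG 1 1 ψ) GPsi.muPi (GPsi.fourierSum M)) < ∞ :=
  lt_of_le_of_lt (iSup₂_le fun M _ => GPsi.gOpNorm_fourierSum_le hψ hsupp M)
    (by simp : (784 : ℝ≥0∞) < ∞)
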